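/- Let $f:\mathbb R^n\to\mathbb R$ be $\mu$-strongly convex ($\mu>0$) and $L$-smooth (its gradient is $L$-Lipschitz), and twice continuously differentiable with $M$-Lipschitz Hessian, all with respect to the Euclidean norm, and let $x^*$ be its minimizer. Fix a step size $h\in\,]0,2/L[$, an integer $k\ge 0$ and $\beta>0$. For $x_0\in\mathbb R^n$ let $\tilde x_0=x_0$, $\tilde x_{i+1}=g(\tilde x_i)$ with $g(x)=x-h\nabla f(x)$, be the iterates of the gradient method, and let $x_{i+1}=x^*+A(x_i-x^*)$, with $A=g'(x^*)$, be the iterates of its linearization at $x^*$, started at the same $x_0$. Let $\tilde U,U\in\mathbb R^{n\times(k+1)}$ be the matrices with columns $\tilde x_{i+1}-\tilde x_i$, respectively $x_{i+1}-x_i$, for $i=0,\dots,k$, let $P=\tilde U^T\tilde U-U^TU$, let $\lambda=\beta\|P\|_2$ (spectral norm), and let $\tilde X=[\tilde x_0,\dots,\tilde x_k]$. Consider the RMPE problem $$\text{minimize } c^T(\tilde U^T\tilde U+\lambda I)c\quad\text{subject to } \mathbf 1^Tc=1,\qquad c\in\mathbb R^{k+1}.$$ Put $$\sigma=1-\frac{\mu}{L},\qquad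 \kappa=\frac{L}{\mu},\qquad \zeta=\frac{1-\sqrt{1-\sigma}}{1+\sqrt{1-\sigma}} .$$ Then there is a neighbourhood of $x^*$ such that for every $x_0$ in it the RMPE problem has a solution, and every solution $\tilde c$ satisfies $$\|\tilde X\tilde c-x^*\|_2\le\left(1+\frac{(1+\frac1\beta)^2}{4\beta^2}\right)^{1/2}\kappa\,\frac{2\zeta^k}{1+\zeta^{2k}}\,\|x_0-x^*\|_2 .$$ Moreover, if $\mu<L$, the factor $\frac{2\zeta^k}{1+\zeta^{2k}}$ is the Chebyshev rate $|T_k(\sigma)|$, where $T_k(x)=C_k(t(x))/C_k(t(1))$, $t(x)=(2x-\sigma)/\sigma$, and $C_k$ is the Chebyshev polynomial of the first kind of degree $k$. -/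

import Mathlib

open scoped Topology Gradient

noncomputable section

namespace RMPE

variable {n : ℕ}

/-- `f` is `L`-smooth: differentiable with an `L`-Lipschitz gradient (Euclidean norm). -/
def LSmooth (L : ℝ) (f : EuclideanSpace ℝ (Fin n) → ℝ) : Prop :=
  Differentiable ℝ f ∧ ∀ x y, ‖∇ f x - ∇ f y‖ ≤ L * ‖x - y‖

/-- The Hessian of `f` at `x`, as the derivative of the gradient field. -/
def hessian (f : EuclideanSpace ℝ (Fin n) → ℝ) (x : EuclideanSpace ℝ (Fin n)) :
    EuclideanSpace ℝ (Fin n) →L[ℝ] EuclideanSpace ℝ (Fin n) :=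
  fderiv ℝ (∇ f) x

/-- `f` is twice continuously differentiable and its Hessian is `M`-Lipschitz
(operator norm induced by the Euclidean norm). -/
def LipschitzHessian (M : ℝ) (f : EuclideanSpace ℝ (Fin n) → ℝ) : Prop :=
  ContDiff ℝ 2 f ∧ ∀ x y, ‖hessian f y - hessian f x‖ ≤ M * ‖y - x‖

/-- One step of the gradient method with step size `h`. -/
def gradStep (f : EuclideanSpace ℝ (Fin n) → ℝ) (h : ℝ) (x : EuclideanSpace ℝ (Fin n)) :
    EuclideanSpace ℝ (Fin n) :=
  x - h • ∇ f x

/-- The iterates `x̃₀ = x₀`, `x̃ᵢ₊₁ = g x̃ᵢ`. -/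
def iter (g : EuclideanSpace ℝ (Fin n) → EuclideanSpace ℝ (Fin n))
    (x₀ : EuclideanSpace ℝ (Fin n)) (i : ℕ) : EuclideanSpace ℝ (Fin n) :=
  g^[i] x₀

/-- The linear model of `g` at `xs`: the affine map `x ↦ xs + A (x - xs)`, with `A` the
derivative of `g` at `xs`. -/
def linModel (g : EuclideanSpace ℝ (Fin n) → EuclideanSpace ℝ (Fin n))
    (xs x : EuclideanSpace ℝ (Fin n)) : EuclideanSpace ℝ (Fin n) :=
  xs + fderiv ℝ g xs (x - xs)

/-- The `n × (k + 1)` matrix with columns `xᵢ₊₁ - xᵢ`, `i = 0, …, k`. -/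
def increments (k : ℕ) (x : ℕ → EuclideanSpace ℝ (Fin n)) :
    Matrix (Fin n) (Fin (k + 1)) ℝ :=
  Matrix.of fun j i => (x ((i : ℕ) + 1) - x i) j

/-- The perturbation matrix `P = Ũᵀ Ũ - Uᵀ U`, where `Ũ` comes from the iterates of `g` and `U`
from the iterates of its linear model at `xs`, both started at `x₀`. -/
def perturbation (g : EuclideanSpace ℝ (Fin n) → EuclideanSpace ℝ (Fin n))
    (xs : EuclideanSpace ℝ (Fin n)) (k : ℕ) (x₀ : EuclideanSpace ℝ (Fin n)) :
    Matrix (Fin (k + 1)) (Fin (k + 1)) ℝ :=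
  (increments k (iter g x₀)).transpose * increments k (iter g x₀) -
    (increments k (iter (linModel g xs) x₀)).transpose * increments k (iter (linModel g xs) x₀)

/-- The spectral norm `‖P‖₂`. -/
def specNorm {m : ℕ} (P : Matrix (Fin m) (Fin m) ℝ) : ℝ :=
  ‖Matrix.toEuclideanCLM (𝕜 := ℝ) P‖

/-- `c` solves: minimize `cᵀ (Uᵀ U + lam I) c` subject to `1ᵀ c = 1`. -/
def IsSolution {k : ℕ} (U : Matrix (Fin n) (Fin (k + 1)) ℝ) (lam : ℝ)
    (c : Fin (k + 1) → ℝ) : Prop :=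
  ∑ i, c i = 1 ∧
    IsMinOn (fun d : Fin (k + 1) → ℝ =>
      dotProduct d ((U.transpose * U + lam • (1 : Matrix _ _ ℝ)).mulVec d))
      {d | ∑ i, d i = 1} c

/-- The extrapolated point `X̃ c = ∑ᵢ cᵢ x̃ᵢ`. -/
def extrapolate {k : ℕ} (x : ℕ → EuclideanSpace ℝ (Fin n)) (c : Fin (k + 1) → ℝ) :
    EuclideanSpace ℝ (Fin n) :=
  ∑ i, c i • x i

/-- The rescaled Chebyshev polynomial `T_k(x) = C_k(t(x)) / C_k(t(1))`, `t(x) = (2x - σ)/σ`,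
for `σ ≠ 0`. -/
def rescaledChebyshev (k : ℕ) (σ x : ℝ) : ℝ :=
  (Polynomial.Chebyshev.T ℝ k).eval ((2 * x - σ) / σ) /
    (Polynomial.Chebyshev.T ℝ k).eval ((2 * 1 - σ) / σ)

/-- `ζ = (1 - √(1 - σ)) / (1 + √(1 - σ))`. -/
def zeta (σ : ℝ) : ℝ := (1 - √(1 - σ)) / (1 + √(1 - σ))

/-- The Chebyshev rate `2 ζᵏ / (1 + ζ²ᵏ)`. -/
def chebyshevRate (k : ℕ) (σ : ℝ) : ℝ :=
  2 * zeta σ ^ k / (1 + zeta σ ^ (2 * k))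

end RMPE

end

open scoped Topology Gradient

/-! The argument is a blow-up at the minimizer. The constant under the square root enters only
through being larger than `1`: for `μ < L` every factor above `κ` times the Chebyshev rate works
near `x*`. If some factor fails, take an ultrafilter of bad starting points tending to `x*` and
divide all errors by `‖x₀ - x*‖`. The normalized iterates tend to `A ^ i v` with `‖v‖ = 1`. The
problem is homogeneous of degree two, so its solutions are unchanged and its regularization becomes
`β ρ`, where `ρ`, the norm of the rescaled `P`, tends to `0`.

The normalized extrapolations then converge to some `z` whose residual `‖(A - 1) z‖` is at most that
of every extrapolation of the limiting linear iteration (`exists_tendsto_minimizers`). If the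
limiting increments are independent, the solutions stay bounded and this is compactness. If they are
dependent, the coefficients may blow up; but the limiting optimal value is `0`, and having
regularization proportional to `‖P‖` forces the extrapolations to `0`
(`tendsto_minimizers_of_combination_eq_zero`).

Since `A - 1 = -h H` with `μ ≤ H ≤ L`, comparing with a shifted Chebyshev polynomial bounds `‖z‖` by
`κ` times the rate (`norm_le_of_residual_le`), a contradiction. For `μ = L` the rate can be `0`,
leaving no slack; there the gradient is affine, `P = 0`, and the bound is proved directly
(`norm_extrapolate_sub_le_of_eq`). -/

namespace RMPE

open Filter
open scoped RealInnerProductSpace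

/-! ### Extrapolations, increments and Krylov polynomials -/

section Combination

variable {E : Type*} [NormedAddCommGroup E] [InnerProductSpace ℝ E] {k : ℕ}

/-- The linear combination `∑ i, c i • y i` of the first `k + 1` terms of a sequence. -/
def combination (y : ℕ → E) : EuclideanSpace ℝ (Fin (k + 1)) →ₗ[ℝ] E where
  toFun c := ∑ i, c i • y i
  map_add' c d := by simp [add_smul, Finset.sum_add_distrib]
  map_smul' r c := by simp [mul_smul, Finset.smul_sum]

/-- The sequence of increments `y (i + 1) - y i`. -/
def diffs (y : ℕ → E) (i : ℕ) : E := y (i + 1) - y i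

/-- The tail sums `j ↦ ∑ i > j, c i`. -/
def tailSum : EuclideanSpace ℝ (Fin (k + 1)) →ₗ[ℝ] EuclideanSpace ℝ (Fin (k + 1)) where
  toFun c := WithLp.toLp 2 fun j => ∑ i, if j < i then c i else 0
  map_add' c d := by
    ext j
    simp only [PiLp.add_apply, ← Finset.sum_add_distrib]
    exact Finset.sum_congr rfl fun i _ => by split_ifs <;> simp
  map_smul' r c := by
    ext j
    simp [Finset.mul_sum]

theorem combination_apply (y : ℕ → E) (c : EuclideanSpace ℝ (Fin (k + 1))) :
    combination y c = ∑ i, c i • y i := rfl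

/-- Summation by parts. It expresses an extrapolation through the increments, the only data whose
Gram matrix `P` controls. -/
theorem combination_eq_add_combination_diffs (y : ℕ → E) (c : EuclideanSpace ℝ (Fin (k + 1))) :
    combination y c = (∑ i, c i) • y 0 + combination (diffs y) (tailSum c) := by
  have h (i : Fin (k + 1)) :
      y i = y 0 + ∑ j : Fin (k + 1), if j < i then diffs y j else 0 := by
    have h1 : ∑ j ∈ Finset.range i, diffs y j = y i - y 0 := Finset.sum_range_sub y i
    have h2 : ∑ j : Fin (k + 1), (if j < i then diffs y j else 0) =
        ∑ j ∈ Finset.range i, diffs y j := by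
      change ∑ j : Fin (k + 1), (if (j : ℕ) < i then diffs y j else 0) = _
      rw [← Finset.sum_range (n := k + 1) fun j => if j < (i : ℕ) then diffs y j else 0,
        ← Finset.sum_filter]
      congr 1
      ext j
      simp only [Finset.mem_filter, Finset.mem_range]
      omega
    rw [h2, h1]; abel
  simp only [combination_apply, tailSum, LinearMap.coe_mk, AddHom.coe_mk]
  conv_lhs => enter [2, i]; rw [h i, smul_add, Finset.smul_sum]
  rw [Finset.sum_add_distrib, ← Finset.sum_smul, Finset.sum_comm]
  congr 1
  refine Finset.sum_congr rfl fun j _ => ?_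
  rw [Finset.sum_smul]
  exact Finset.sum_congr rfl fun i _ => by split_ifs <;> simp

theorem combination_map (B : E →L[ℝ] E) (y : ℕ → E) (c : EuclideanSpace ℝ (Fin (k + 1))) :
    combination (fun i => B (y i)) c = B (combination y c) := by
  simp [combination_apply, map_sum]

theorem combination_smul (r : ℝ) (y : ℕ → E) (c : EuclideanSpace ℝ (Fin (k + 1))) :
    combination (fun i => r • y i) c = r • combination y c := by
  simp [combination_apply, Finset.smul_sum, smul_comm r]

theorem tendsto_combination {α : Type*} {l : Filter α} {y : α → ℕ → E} {z : ℕ → E}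
    {c : α → EuclideanSpace ℝ (Fin (k + 1))} {d : EuclideanSpace ℝ (Fin (k + 1))}
    (hy : ∀ i, Tendsto (fun a => y a i) l (𝓝 (z i))) (hc : Tendsto c l (𝓝 d)) :
    Tendsto (fun a => combination (y a) (c a)) l (𝓝 (combination z d)) := by
  simp only [combination_apply]
  refine tendsto_finsetSum _ fun i _ => Tendsto.smul ?_ (hy i)
  exact ((PiLp.continuous_apply 2 _ i).tendsto d).comp hc

theorem norm_combination_sub_le (y z : ℕ → E) (c : EuclideanSpace ℝ (Fin (k + 1))) :
    ‖combination y c - combination z c‖ ≤ (∑ i : Fin (k + 1), ‖y i - z i‖) * ‖c‖ := by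
  simp only [combination_apply, ← Finset.sum_sub_distrib, ← smul_sub, Finset.sum_mul]
  refine (norm_sum_le _ _).trans (Finset.sum_le_sum fun i _ => ?_)
  rw [norm_smul, mul_comm]
  gcongr
  exact PiLp.norm_apply_le c i

theorem tendsto_diffs {F α : Type*} [NormedAddCommGroup F] {l : Filter α} {y : α → ℕ → F}
    {z : ℕ → F} (hy : ∀ i, Tendsto (fun a => y a i) l (𝓝 (z i))) (i : ℕ) :
    Tendsto (fun a => diffs (y a) i) l (𝓝 (diffs z i)) :=
  (hy (i + 1)).sub (hy i)

theorem combination_diffs_pow (A : E →L[ℝ] E) (w : E) (c : EuclideanSpace ℝ (Fin (k + 1))) :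
    combination (diffs fun i => (A ^ i) w) c =
      (A - 1) (combination (fun i => (A ^ i) w) c) := by
  rw [← combination_map]
  congr 2
  funext i
  simp [diffs, pow_succ']

/-- The coefficient vector of a polynomial of degree at most `k`. -/
def coeffs (k : ℕ) (p : Polynomial ℝ) : EuclideanSpace ℝ (Fin (k + 1)) :=
  WithLp.toLp 2 fun i => p.coeff i

theorem sum_coeffs {p : Polynomial ℝ} (hp : p.natDegree ≤ k) :
    ∑ i, coeffs k p i = p.eval 1 := by
  rw [Polynomial.eval_eq_sum_range' (Nat.lt_succ_of_le hp), Finset.sum_range]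
  simp [coeffs]

theorem combination_coeffs {p : Polynomial ℝ} (hp : p.natDegree ≤ k) (A : E →L[ℝ] E) (w : E) :
    combination (fun i => (A ^ i) w) (coeffs k p) = Polynomial.aeval A p w := by
  rw [Polynomial.aeval_eq_sum_range' (Nat.lt_succ_of_le hp), Finset.sum_range]
  simp [coeffs, combination_apply]

/-- If the Krylov increments are linearly dependent, then some polynomial of degree at most `k`
with value `1` at `1` annihilates the starting vector. -/
theorem exists_combination_eq_zero_of_not_injective {A : E →L[ℝ] E}
    (hA : Function.Injective (A - 1 : E →L[ℝ] E)) {v : E}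
    (h : ¬ Function.Injective
      (combination (k := k) (diffs fun i => (A ^ i) v))) :
    ∃ d : EuclideanSpace ℝ (Fin (k + 1)), ∑ i, d i = 1 ∧
      combination (fun i => (A ^ i) v) d = 0 := by
  rw [← LinearMap.ker_eq_bot, LinearMap.ker_eq_bot'] at h
  push Not at h
  obtain ⟨c, hc, hc0⟩ := h
  rw [combination_diffs_pow, ← map_zero (A - 1 : E →L[ℝ] E)] at hc
  replace hc := hA hc
  set p : Polynomial ℝ := Polynomial.ofFn (k + 1) c with hp
  have hpk : p.natDegree ≤ k :=
    Nat.lt_succ_iff.1 (Polynomial.ofFn_natDegree_lt (Nat.le_add_left 1 k) _)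
  have hcp : coeffs k p = c := by
    ext i
    exact Polynomial.ofFn_coeff_eq_val_of_lt _ i.2
  have hp0 : p ≠ 0 := by
    rintro h0
    apply hc0
    rw [← hcp, h0]
    ext i
    simp [coeffs]
  rw [← hcp, combination_coeffs hpk] at hc
  -- Split off all factors `X - 1`. As `A - 1` is injective, the cofactor `q` still annihilates `v`,
  -- and `q(1) ≠ 0` allows normalization.
  obtain ⟨q, hq, hdvd⟩ := p.exists_eq_pow_rootMultiplicity_mul_and_not_dvd hp0 1
  have hq1 : q.eval 1 ≠ 0 := fun h => hdvd (Polynomial.dvd_iff_isRoot.2 h)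
  have hqv : Polynomial.aeval A q v = 0 := by
    have hinj : ∀ m : ℕ, Function.Injective ((A - 1) ^ m : E →L[ℝ] E) := fun m => by
      rw [FunLike.coe_pow_eq_iterate]
      exact hA.iterate m
    apply hinj (p.rootMultiplicity 1)
    rw [map_zero, ← hc]
    conv_rhs => rw [hq]
    simp
  have hqk : q.natDegree ≤ k := by
    refine le_trans ?_ hpk
    have hq0 : q ≠ 0 := by rintro rfl; simp at hq1
    refine Polynomial.natDegree_le_of_dvd ?_ hp0
    exact ⟨_, by rw [mul_comm]; exact hq⟩
  refine ⟨coeffs k (Polynomial.C (q.eval 1)⁻¹ * q), ?_, ?_⟩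
  · rw [sum_coeffs ((Polynomial.natDegree_C_mul_le _ _).trans hqk)]
    simp [hq1]
  · rw [combination_coeffs ((Polynomial.natDegree_C_mul_le _ _).trans hqk)]
    simp [hqv, Algebra.algebraMap_eq_smul_one]

end Combination

/-! ### Limits of regularized minimizers -/

section Minimizers

variable {E : Type*} [NormedAddCommGroup E] [InnerProductSpace ℝ E] {k : ℕ}

/-- Regularized minimizers converge when the limiting increments are independent. -/
theorem tendsto_minimizers_of_injective {α : Type*} (l : Ultrafilter α) {z : ℕ → E}
    (hz : Function.Injective (combination (k := k) (diffs z)))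
    {y : α → ℕ → E} (hy : ∀ i, Tendsto (fun a => y a i) l (𝓝 (z i)))
    {τ : α → ℝ} (hτ0 : ∀ a, 0 ≤ τ a) (hτ : Tendsto τ l (𝓝 0))
    {c : α → EuclideanSpace ℝ (Fin (k + 1))}
    (hmin : ∀ d : EuclideanSpace ℝ (Fin (k + 1)), ∑ i, d i = 1 → ∀ᶠ a in l,
      ‖combination (diffs (y a)) (c a)‖ ^ 2 + τ a * ‖c a‖ ^ 2 ≤
        ‖combination (diffs (y a)) d‖ ^ 2 + τ a * ‖d‖ ^ 2) :
    ∃ e : EuclideanSpace ℝ (Fin (k + 1)),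
      Tendsto (fun a => combination (y a) (c a)) l (𝓝 (combination z e)) ∧
      ∀ d : EuclideanSpace ℝ (Fin (k + 1)), ∑ i, d i = 1 →
        ‖combination (diffs z) e‖ ≤ ‖combination (diffs z) d‖ := by
  have hy' := tendsto_diffs hy
  have hval (d : EuclideanSpace ℝ (Fin (k + 1))) :
      Tendsto (fun a => ‖combination (diffs (y a)) d‖ ^ 2 + τ a * ‖d‖ ^ 2) l
        (𝓝 (‖combination (diffs z) d‖ ^ 2)) := by
    simpa using ((tendsto_combination hy' (tendsto_const_nhds (x := d))).norm.pow 2).add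
      (hτ.mul_const (‖d‖ ^ 2))
  have hle (d : EuclideanSpace ℝ (Fin (k + 1))) (hd : ∑ i, d i = 1) : ∀ᶠ a in l,
      ‖combination (diffs (y a)) (c a)‖ ^ 2 ≤
        ‖combination (diffs (y a)) d‖ ^ 2 + τ a * ‖d‖ ^ 2 := by
    filter_upwards [hmin d hd] with a ha
    have := mul_nonneg (hτ0 a) (sq_nonneg ‖c a‖)
    linarith
  obtain ⟨K, hK0, hK⟩ := (combination (k := k) (diffs z)).exists_antilipschitzWith
    (LinearMap.ker_eq_bot.2 hz)
  have hK0' : (0 : ℝ) < K := hK0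
  have hKle (b : EuclideanSpace ℝ (Fin (k + 1))) : ‖b‖ ≤ K * ‖combination (diffs z) b‖ := by
    simpa using hK.le_mul_dist b 0
  have hdist : Tendsto (fun a => ∑ i : Fin (k + 1), ‖diffs (y a) i - diffs z i‖) l (𝓝 0) := by
    rw [show (0 : ℝ) = ∑ i : Fin (k + 1), ‖diffs z i - diffs z i‖ by simp]
    exact tendsto_finsetSum _ fun i _ => ((hy' i).sub_const _).norm
  obtain ⟨R, hR⟩ : ∃ R, ∀ᶠ a in l, ‖c a‖ ≤ R := by
    obtain ⟨d, hd⟩ : ∃ d : EuclideanSpace ℝ (Fin (k + 1)), ∑ i, d i = 1 :=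
      ⟨EuclideanSpace.single 0 1, by simp⟩
    set V := ‖combination (diffs z) d‖ ^ 2 + 1
    -- Once the increments are within `1 / (2K)` of their limits, the perturbation costs at most
    -- `‖c‖ / 2` in the antilipschitz bound; absorbing it doubles `K √V`.
    refine ⟨2 * K * √V, ?_⟩
    filter_upwards [hle d hd, (hval d).eventually_lt_const (lt_add_one _),
      hdist.eventually_lt_const (show (0 : ℝ) < (2 * (K : ℝ))⁻¹ by positivity)] with a h1 h2 h3
    have h4 : ‖combination (diffs (y a)) (c a)‖ ≤ √V :=
      Real.le_sqrt_of_sq_le (h1.trans h2.le)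
    have h5 := norm_combination_sub_le (diffs (y a)) (diffs z) (c a)
    have h6 : (∑ i : Fin (k + 1), ‖diffs (y a) i - diffs z i‖) * ‖c a‖ ≤ (2 * (K : ℝ))⁻¹ * ‖c a‖ := by
      gcongr
    have h7 : ‖combination (diffs z) (c a)‖ ≤ √V + (2 * (K : ℝ))⁻¹ * ‖c a‖ := by
      have := norm_sub_norm_le (combination (diffs z) (c a)) (combination (diffs (y a)) (c a))
      rw [norm_sub_rev] at this
      linarith
    have h8 : ‖c a‖ ≤ K * √V + ‖c a‖ / 2 := by
      refine ((hKle (c a)).trans (mul_le_mul_of_nonneg_left h7 hK0'.le)).trans_eq ?_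
      field_simp
    linarith
  obtain ⟨e, -, he⟩ := (isCompact_closedBall (0 : EuclideanSpace ℝ (Fin (k + 1))) R)
    |>.ultrafilter_le_nhds (l.map c) (by
      rw [Ultrafilter.coe_map, le_principal_iff, mem_map]
      filter_upwards [hR] with a ha
      simpa using ha)
  replace he : Tendsto c l (𝓝 e) := he
  refine ⟨e, tendsto_combination hy he, fun d hd => ?_⟩
  have h := le_of_tendsto_of_tendsto ((tendsto_combination hy' he).norm.pow 2) (hval d) (hle d hd)
  exact (pow_le_pow_iff_left₀ (norm_nonneg _) (norm_nonneg _) two_ne_zero).1 h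

/-- When the limiting problem has optimal value `0`, the regularized extrapolations tend to `0`
if the Gram matrices of the increments differ by `ρ` from those of the linear iteration and the
regularization is at least proportional to `ρ`. -/
theorem tendsto_minimizers_of_combination_eq_zero {α : Type*} {l : Filter α} {A : E →L[ℝ] E}
    {m β : ℝ} (hm : 0 < m) (hA : ∀ z, m * ‖z‖ ≤ ‖(A - 1 : E →L[ℝ] E) z‖) (hβ : 0 < β) {v : E}
    {y : α → ℕ → E} (hy : ∀ i, Tendsto (fun a => y a i) l (𝓝 ((A ^ i) v)))
    {ρ : α → ℝ} (hρ0 : ∀ a, 0 ≤ ρ a) (hρ : Tendsto ρ l (𝓝 0))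
    (hP : ∀ a, ∀ b d : EuclideanSpace ℝ (Fin (k + 1)),
      |⟪combination (diffs (y a)) b, combination (diffs (y a)) d⟫ -
        ⟪combination (diffs fun i => (A ^ i) (y a 0)) b,
          combination (diffs fun i => (A ^ i) (y a 0)) d⟫| ≤ ρ a * ‖b‖ * ‖d‖)
    {c : α → EuclideanSpace ℝ (Fin (k + 1))} (hc : ∀ᶠ a in l, ∑ i, c a i = 1)
    {d : EuclideanSpace ℝ (Fin (k + 1))} (hd : ∑ i, d i = 1)
    (hd0 : combination (fun i => (A ^ i) v) d = 0)
    (hmin : ∀ᶠ a in l,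
      ‖combination (diffs (y a)) (c a)‖ ^ 2 + β * ρ a * ‖c a‖ ^ 2 ≤
        ‖combination (diffs (y a)) d‖ ^ 2 + β * ρ a * ‖d‖ ^ 2) :
    Tendsto (fun a => combination (y a) (c a)) l (𝓝 0) := by
  have hy' := tendsto_diffs hy
  have hy0 : Tendsto (fun a => y a 0) l (𝓝 v) := by simpa using hy 0
  have hval : Tendsto (fun a => ‖combination (diffs (y a)) d‖ ^ 2 + β * ρ a * ‖d‖ ^ 2) l
      (𝓝 0) := by
    have h := ((tendsto_combination hy' (tendsto_const_nhds (x := d))).norm.pow 2).add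
      ((hρ.const_mul β).mul_const (‖d‖ ^ 2))
    rwa [combination_diffs_pow, hd0, map_zero, norm_zero, mul_zero, zero_mul, zero_pow two_ne_zero,
      add_zero] at h
  have hU : Tendsto (fun a => ‖combination (diffs (y a)) (c a)‖ ^ 2) l (𝓝 0) := by
    refine squeeze_zero' (Eventually.of_forall fun a => sq_nonneg _) ?_ hval
    filter_upwards [hmin] with a ha
    have := mul_nonneg (mul_nonneg hβ.le (hρ0 a)) (sq_nonneg ‖c a‖)
    linarith
  -- Here `β > 0` matters: `c` may be unbounded, but the penalty is at most an objective value
  -- tending to `0`.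
  have hρc : Tendsto (fun a => ρ a * ‖c a‖ ^ 2) l (𝓝 0) := by
    have h : Tendsto (fun a => β * ρ a * ‖c a‖ ^ 2) l (𝓝 0) := by
      refine squeeze_zero' (Eventually.of_forall fun a =>
        mul_nonneg (mul_nonneg hβ.le (hρ0 a)) (sq_nonneg ‖c a‖)) ?_ hval
      filter_upwards [hmin] with a ha
      have := sq_nonneg ‖combination (diffs (y a)) (c a)‖
      linarith
    have h2 := h.const_mul β⁻¹
    simp only [mul_zero, mul_assoc] at h2
    simpa [inv_mul_cancel_left₀ hβ.ne'] using h2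
  -- the linear iteration with the same coefficients also extrapolates to zero
  have hX : Tendsto (fun a => combination (fun i => (A ^ i) (y a 0)) (c a)) l (𝓝 0) := by
    rw [tendsto_zero_iff_norm_tendsto_zero]
    have h : Tendsto (fun a => m⁻¹ * √(‖combination (diffs (y a)) (c a)‖ ^ 2 +
        ρ a * ‖c a‖ ^ 2)) l (𝓝 0) := by
      simpa using ((hU.add hρc).sqrt).const_mul m⁻¹
    refine squeeze_zero (fun a => norm_nonneg _) (fun a => ?_) h
    rw [← div_eq_inv_mul, le_div_iff₀' hm]
    -- `A - 1` sends the linear extrapolation to `U c`, and `‖U c‖² ≤ ‖Ũ c‖² + ρ ‖c‖²`.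
    refine (hA _).trans (Real.le_sqrt_of_sq_le ?_)
    rw [← combination_diffs_pow]
    have := (abs_le.1 (hP a (c a) (c a))).1
    rw [real_inner_self_eq_norm_sq, real_inner_self_eq_norm_sq] at this
    nlinarith
  obtain ⟨K, hK0, hK⟩ : ∃ K : ℝ, 0 < K ∧
      ∀ b : EuclideanSpace ℝ (Fin (k + 1)), ‖tailSum b‖ ≤ K * ‖b‖ := by
    obtain ⟨K, hK0, hK⟩ := (LinearMap.toContinuousLinearMap (tailSum (k := k))).bound
    exact ⟨K, hK0, hK⟩
  set s := fun a => tailSum (c a) with hs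
  have hρs : Tendsto (fun a => ρ a * ‖s a‖ ^ 2) l (𝓝 0) := by
    refine squeeze_zero (fun a => mul_nonneg (hρ0 a) (sq_nonneg _)) (fun a => ?_)
      (by simpa using hρc.const_mul (K ^ 2))
    calc ρ a * ‖s a‖ ^ 2 ≤ ρ a * (K * ‖c a‖) ^ 2 := by
          have := hρ0 a
          gcongr
          exact hK _
      _ = K ^ 2 * (ρ a * ‖c a‖ ^ 2) := by ring
  have hρs1 : Tendsto (fun a => ρ a * ‖s a‖) l (𝓝 0) := by
    refine squeeze_zero (fun a => mul_nonneg (hρ0 a) (norm_nonneg _)) (fun a => ?_)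
      (by simpa using hρ.add hρs)
    nlinarith [hρ0 a, sq_nonneg (‖s a‖ - 1), norm_nonneg (s a),
      mul_nonneg (hρ0 a) (sq_nonneg (‖s a‖ - 1)), mul_nonneg (hρ0 a) (sq_nonneg ‖s a‖)]
  have hUs : Tendsto (fun a => combination (diffs fun i => (A ^ i) (y a 0)) (s a)) l
      (𝓝 (-v)) := by
    have h : Tendsto (fun a => combination (fun i => (A ^ i) (y a 0)) (c a) - y a 0) l
        (𝓝 (-v)) := by
      simpa using hX.sub hy0
    refine h.congr' ?_
    filter_upwards [hc] with a ha
    rw [combination_eq_add_combination_diffs, ha]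
    simp [hs]
  -- `ρ ‖s‖² → 0` transfers squared norms, not vectors, from `U s` to `Ũ s`. To get `Ũ s → -v`,
  -- compare with `Ũ b` for the fixed `b` with `U b → -v`: the norms and the inner product all tend
  -- to `‖v‖²`, so the distance tends to `0`.
  have hnorm : Tendsto (fun a => ‖combination (diffs (y a)) (s a)‖ ^ 2) l (𝓝 (‖v‖ ^ 2)) := by
    have h1 : Tendsto (fun a => ‖combination (diffs (y a)) (s a)‖ ^ 2 -
        ‖combination (diffs fun i => (A ^ i) (y a 0)) (s a)‖ ^ 2) l (𝓝 0) := by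
      refine squeeze_zero_norm (fun a => ?_) hρs
      have := hP a (s a) (s a)
      rw [real_inner_self_eq_norm_sq, real_inner_self_eq_norm_sq] at this
      rw [Real.norm_eq_abs, sq ‖s a‖, ← mul_assoc]
      exact this
    simpa using h1.add (hUs.norm.pow 2)
  set b := tailSum d with hb
  have hvb : combination (diffs fun i => (A ^ i) v) b = -v := by
    have := combination_eq_add_combination_diffs (fun i => (A ^ i) v) d
    rw [hd0, hd] at this
    simp only [one_smul, pow_zero, one_apply_eq_self] at this
    exact (neg_eq_of_add_eq_zero_right this.symm).symm
  have hyb : Tendsto (fun a => combination (diffs (y a)) b) l (𝓝 (-v)) :=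
    hvb ▸ tendsto_combination hy' tendsto_const_nhds
  have hAb : Tendsto (fun a => combination (diffs fun i => (A ^ i) (y a 0)) b) l (𝓝 (-v)) :=
    hvb ▸ tendsto_combination
      (tendsto_diffs fun i => (((A ^ i).continuous.tendsto v).comp hy0)) tendsto_const_nhds
  have hinner : Tendsto (fun a => ⟪combination (diffs (y a)) (s a),
      combination (diffs (y a)) b⟫) l (𝓝 (‖v‖ ^ 2)) := by
    have h1 : Tendsto (fun a => ⟪combination (diffs (y a)) (s a), combination (diffs (y a)) b⟫ -
        ⟪combination (diffs fun i => (A ^ i) (y a 0)) (s a),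
          combination (diffs fun i => (A ^ i) (y a 0)) b⟫) l (𝓝 0) := by
      refine squeeze_zero_norm (fun a => hP a (s a) b) ?_
      simpa using hρs1.mul_const ‖b‖
    simpa [real_inner_self_eq_norm_sq] using h1.add (hUs.inner hAb)
  have hsub : Tendsto (fun a => combination (diffs (y a)) (s a) - combination (diffs (y a)) b) l
      (𝓝 0) := by
    rw [tendsto_zero_iff_norm_tendsto_zero]
    have h1 : Tendsto (fun a => ‖combination (diffs (y a)) (s a) -
        combination (diffs (y a)) b‖ ^ 2) l (𝓝 0) := by
      simp only [norm_sub_sq_real]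
      have h2 := (hnorm.sub (hinner.const_mul 2)).add (hyb.norm.pow 2)
      rw [norm_neg] at h2
      convert h2 using 2
      ring
    simpa using h1.sqrt
  have h := (hsub.add hyb).add hy0
  rw [zero_add, neg_add_cancel] at h
  refine h.congr' ?_
  filter_upwards [hc] with a ha
  rw [combination_eq_add_combination_diffs (y a) (c a), ha, one_smul, sub_add_cancel, add_comm]

/-- Limits of normalized regularized extrapolations are at least as good, in residual, as every
fixed extrapolation of the limiting linear iteration. -/
theorem exists_tendsto_minimizers {α : Type*} (l : Ultrafilter α) {A : E →L[ℝ] E}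
    {m β : ℝ} (hm : 0 < m) (hA : ∀ z, m * ‖z‖ ≤ ‖(A - 1 : E →L[ℝ] E) z‖) (hβ : 0 < β) {v : E}
    {y : α → ℕ → E} (hy : ∀ i, Tendsto (fun a => y a i) l (𝓝 ((A ^ i) v)))
    {ρ : α → ℝ} (hρ0 : ∀ a, 0 ≤ ρ a) (hρ : Tendsto ρ l (𝓝 0))
    (hP : ∀ a, ∀ b d : EuclideanSpace ℝ (Fin (k + 1)),
      |⟪combination (diffs (y a)) b, combination (diffs (y a)) d⟫ -
        ⟪combination (diffs fun i => (A ^ i) (y a 0)) b,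
          combination (diffs fun i => (A ^ i) (y a 0)) d⟫| ≤ ρ a * ‖b‖ * ‖d‖)
    {c : α → EuclideanSpace ℝ (Fin (k + 1))} (hc : ∀ᶠ a in l, ∑ i, c a i = 1)
    (hmin : ∀ d : EuclideanSpace ℝ (Fin (k + 1)), ∑ i, d i = 1 → ∀ᶠ a in l,
      ‖combination (diffs (y a)) (c a)‖ ^ 2 + β * ρ a * ‖c a‖ ^ 2 ≤
        ‖combination (diffs (y a)) d‖ ^ 2 + β * ρ a * ‖d‖ ^ 2) :
    ∃ z, Tendsto (fun a => combination (y a) (c a)) l (𝓝 z) ∧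
      ∀ d : EuclideanSpace ℝ (Fin (k + 1)), ∑ i, d i = 1 →
        ‖(A - 1 : E →L[ℝ] E) z‖ ≤
          ‖(A - 1 : E →L[ℝ] E) (combination (fun i => (A ^ i) v) d)‖ := by
  by_cases hinj : Function.Injective (combination (k := k) (diffs fun i => (A ^ i) v))
  · obtain ⟨e, he, hle⟩ := tendsto_minimizers_of_injective l hinj hy (τ := fun a => β * ρ a)
      (fun a => mul_nonneg hβ.le (hρ0 a)) (by simpa using hρ.const_mul β) hmin
    refine ⟨_, he, fun d hd => ?_⟩
    simpa only [combination_diffs_pow] using hle d hd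
  · have hA' : Function.Injective (A - 1 : E →L[ℝ] E) := by
      rw [injective_iff_map_eq_zero]
      intro z hz
      have := hA z
      rw [hz, norm_zero] at this
      exact norm_le_zero_iff.1 (nonpos_of_mul_nonpos_right this hm)
    obtain ⟨d, hd, hd0⟩ := exists_combination_eq_zero_of_not_injective hA' hinj
    refine ⟨0, tendsto_minimizers_of_combination_eq_zero hm hA hβ hy hρ0 hρ hP hc hd hd0
      (hmin d hd), fun d _ => ?_⟩
    rw [map_zero, norm_zero]
    exact norm_nonneg _

end Minimizers

/-! ### The Chebyshev rate -/

section Chebyshev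

/-- This is `C_k((ζ + ζ⁻¹) / 2) = (ζᵏ + ζ⁻ᵏ) / 2` with denominators cleared, by the three-term
recurrence. -/
theorem eval_chebyshev_T_of_mul_eq {ζ x : ℝ} (hx : 2 * ζ * x = 1 + ζ ^ 2) (k : ℕ) :
    2 * ζ ^ k * (Polynomial.Chebyshev.T ℝ k).eval x = 1 + ζ ^ (2 * k) := by
  induction k using Nat.twoStepInduction with
  | zero => norm_num
  | one => simpa using hx
  | more k h0 h1 =>
    push_cast at h1 ⊢
    rw [Polynomial.Chebyshev.T_add_two]
    simp only [Polynomial.eval_sub, Polynomial.eval_mul, Polynomial.eval_X, Polynomial.eval_ofNat]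
    linear_combination 2 * ζ * x * h1 - ζ ^ 2 * h0 + (1 + ζ ^ (2 * k + 2)) * hx

theorem zeta_pos {σ : ℝ} (h0 : 0 < σ) : 0 < zeta σ := by
  have h : √(1 - σ) < 1 := (Real.sqrt_lt' one_pos).2 (by linarith)
  have := Real.sqrt_nonneg (1 - σ)
  exact div_pos (by linarith) (by linarith)

theorem chebyshevRate_pos {σ : ℝ} (h0 : 0 < σ) (k : ℕ) : 0 < chebyshevRate k σ := by
  have := zeta_pos h0
  unfold chebyshevRate
  positivity

theorem chebyshevRate_mul_eval {σ : ℝ} (h0 : 0 < σ) (h1 : σ < 1) (k : ℕ) :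
    chebyshevRate k σ * (Polynomial.Chebyshev.T ℝ k).eval ((2 * 1 - σ) / σ) = 1 := by
  have hz := zeta_pos h0
  have h : 2 * zeta σ * ((2 * 1 - σ) / σ) = 1 + zeta σ ^ 2 := by
    have hs := Real.sqrt_nonneg (1 - σ)
    have hsq := Real.sq_sqrt (sub_nonneg.2 h1.le)
    have : 1 + √(1 - σ) ≠ 0 := by positivity
    unfold zeta
    generalize √(1 - σ) = s at *
    obtain rfl : σ = 1 - s ^ 2 := by linarith
    field_simp
    ring
  have h2 := eval_chebyshev_T_of_mul_eq h k
  unfold chebyshevRate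
  rw [div_mul_eq_mul_div, h2, div_self]
  positivity

theorem abs_rescaledChebyshev_self {σ : ℝ} (h0 : 0 < σ) (h1 : σ < 1) (k : ℕ) :
    |rescaledChebyshev k σ σ| = chebyshevRate k σ := by
  have h := chebyshevRate_mul_eval h0 h1 k
  have hpos := chebyshevRate_pos h0 k
  have hσ : (2 * σ - σ) / σ = 1 := by field_simp; ring
  rw [rescaledChebyshev, hσ, Polynomial.Chebyshev.T_eval_one, eq_comm, ← eq_div_of_mul_eq _ h,
    abs_of_pos hpos]
  rintro h'
  rw [h', mul_zero] at h
  exact zero_ne_one h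

/-- A polynomial attaining the Chebyshev rate on the spectrum of a gradient step. -/
theorem exists_polynomial_abs_eval_le {μ L h : ℝ} (hμ : 0 < μ) (hμL : μ ≤ L) (hh : h ≠ 0)
    (k : ℕ) :
    ∃ p : Polynomial ℝ, p.natDegree ≤ k ∧ p.eval 1 = 1 ∧
      ∀ t ∈ Set.Icc μ L, |p.eval (1 - h * t)| ≤ chebyshevRate k (1 - μ / L) := by
  have hL : 0 < L := hμ.trans_le hμL
  rcases hμL.eq_or_lt with rfl | hlt
  · rcases Nat.eq_zero_or_pos k with rfl | hk
    · exact ⟨1, by simp, by simp, fun t _ => by simp [chebyshevRate]; norm_num⟩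
    -- The interval is one point and the rate is `0`, as `ζ = 0` and `k ≥ 1`; so use the linear
    -- polynomial vanishing at `1 - h μ`.
    · refine ⟨Polynomial.C (h * μ)⁻¹ * (Polynomial.X - Polynomial.C (1 - h * μ)), ?_, ?_, ?_⟩
      · exact (Polynomial.natDegree_C_mul_le _ _).trans (by rw [Polynomial.natDegree_X_sub_C]; omega)
      · have := hμ.ne'
        simp
        field_simp
      · rintro t ⟨ht1, ht2⟩
        obtain rfl := le_antisymm ht1 ht2
        simp [chebyshevRate, zeta, hμ.ne', hk.ne']
  · have hσ0 : 0 < 1 - μ / L := by rw [sub_pos, div_lt_one hL]; exact hlt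
    have hσ1 : 1 - μ / L < 1 := by simp; positivity
    have hrate := chebyshevRate_mul_eval hσ0 hσ1 k
    set D := L - μ with hD
    have hDpos : 0 < D := sub_pos.2 hlt
    have hx0 : (2 * 1 - (1 - μ / L)) / (1 - μ / L) = (L + μ) / D := by
      rw [hD] at *; field_simp; ring
    rw [hx0] at hrate
    -- The inner affine map sends `1 - h t` to `(L + μ - 2t) / (L - μ)`, taking `[μ, L]` to `[-1,
    -- 1]` and the point `1` (`t = 0`) to the normalization point.
    refine ⟨Polynomial.C (chebyshevRate k (1 - μ / L)) *
      (Polynomial.Chebyshev.T ℝ k).comp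
        (Polynomial.C (2 / (h * D)) * Polynomial.X + Polynomial.C ((L + μ) / D - 2 / (h * D))),
      ?_, ?_, ?_⟩
    · refine (Polynomial.natDegree_C_mul_le _ _).trans (Polynomial.natDegree_comp_le.trans ?_)
      have h1 : (Polynomial.Chebyshev.T ℝ k).natDegree = k := by simp
      rw [h1]
      exact (Nat.mul_le_mul_left k (Polynomial.natDegree_linear_le)).trans (by simp)
    · simpa using hrate
    · rintro t ⟨ht1, ht2⟩
      have hlin : 2 / (h * D) * (1 - h * t) + ((L + μ) / D - 2 / (h * D)) =
          (L + μ - 2 * t) / D := by field_simp; ring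
      simp only [Polynomial.eval_mul, Polynomial.eval_C, Polynomial.eval_comp, Polynomial.eval_add,
        Polynomial.eval_X, hlin, abs_mul, abs_of_pos (chebyshevRate_pos hσ0 k)]
      refine mul_le_of_le_one_right (chebyshevRate_pos hσ0 k).le
        (Polynomial.Chebyshev.abs_eval_T_real_le_one _ ?_)
      rw [abs_le, le_div_iff₀ hDpos, div_le_one hDpos]
      constructor <;> linarith

end Chebyshev

/-! ### Polynomials of a symmetric operator -/

section Spectral

variable {E : Type*} [NormedAddCommGroup E] [InnerProductSpace ℝ E]

theorem toLinearMap_aeval (H : E →L[ℝ] E) (q : Polynomial ℝ) :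
    (Polynomial.aeval H q : E →L[ℝ] E).toLinearMap = Polynomial.aeval H.toLinearMap q := by
  induction q using Polynomial.induction_on' with
  | add p q hp hq => simp [hp, hq]
  | monomial n a => simp [Polynomial.aeval_monomial, Algebra.algebraMap_eq_smul_one]

/-- In an orthonormal eigenbasis `q(H)` acts diagonally by the values of `q` at eigenvalues, which
lie in `[a, b]`. -/
theorem norm_aeval_le_of_isSymmetric [FiniteDimensional ℝ E] {H : E →L[ℝ] E}
    (hH : H.toLinearMap.IsSymmetric) {a b C : ℝ}
    (ha : ∀ z, a * ‖z‖ ^ 2 ≤ ⟪H z, z⟫) (hb : ∀ z, ⟪H z, z⟫ ≤ b * ‖z‖ ^ 2)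
    {q : Polynomial ℝ} (hC : 0 ≤ C) (hq : ∀ t ∈ Set.Icc a b, |q.eval t| ≤ C) (v : E) :
    ‖Polynomial.aeval H q v‖ ≤ C * ‖v‖ := by
  set e := hH.eigenvectorBasis rfl
  set t := hH.eigenvalues rfl
  have he (i) : H (e i) = t i • e i := hH.apply_eigenvectorBasis rfl i
  have ht (i) : t i ∈ Set.Icc a b := by
    have h1 := ha (e i)
    have h2 := hb (e i)
    rw [he, real_inner_smul_left, real_inner_self_eq_norm_sq, e.norm_eq_one] at h1 h2
    constructor <;> linarith
  have hqe (i) : Polynomial.aeval H q (e i) = q.eval (t i) • e i := by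
    have h1 : Polynomial.aeval H q (e i) = Polynomial.aeval H.toLinearMap q (e i) := by
      rw [← toLinearMap_aeval]; rfl
    rw [h1]
    exact Module.End.aeval_apply_of_hasEigenvector
      ⟨Module.End.mem_eigenspace_iff.2 (he i), e.orthonormal.ne_zero i⟩
  have hv : Polynomial.aeval H q v = ∑ i, (q.eval (t i) * e.repr v i) • e i := by
    conv_lhs => rw [← e.sum_repr v, map_sum]
    exact Finset.sum_congr rfl fun i _ => by rw [map_smul, hqe, smul_smul, mul_comm]
  have hrepr (i) : e.repr (Polynomial.aeval H q v) i = q.eval (t i) * e.repr v i := by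
    rw [hv, e.repr_apply_apply, e.orthonormal.inner_right_fintype]
  rw [← e.repr.norm_map, ← e.repr.norm_map v, EuclideanSpace.norm_eq, EuclideanSpace.norm_eq,
    ← Real.sqrt_sq hC, ← Real.sqrt_mul (sq_nonneg C), Finset.mul_sum]
  refine Real.sqrt_le_sqrt (Finset.sum_le_sum fun i _ => ?_)
  rw [hrepr, norm_mul, mul_pow]
  gcongr
  exact hq _ (ht i)

end Spectral

/-! ### Gradient and Hessian of a strongly convex function -/

section Gradient

variable {E : Type*} [NormedAddCommGroup E] [InnerProductSpace ℝ E] [CompleteSpace E]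

/-- `f - μ/2 ‖·‖²` is convex; on the line from `y` to `x` its slope lies between the derivatives at
the endpoints. -/
theorem strongly_monotone_gradient {f : E → ℝ} {μ : ℝ} (hf : StrongConvexOn Set.univ μ f)
    (hd : Differentiable ℝ f) (x y : E) : μ * ‖x - y‖ ^ 2 ≤ ⟪∇ f x - ∇ f y, x - y⟫ := by
  rw [strongConvexOn_iff_convex] at hf
  have hφ := hf.comp_affineMap (AffineMap.lineMap y x)
  rw [Set.preimage_univ] at hφ
  have hder (t : ℝ) : HasDerivAt ((fun z => f z - μ / 2 * ‖z‖ ^ 2) ∘ AffineMap.lineMap y x)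
      (⟪∇ f (AffineMap.lineMap y x t), x - y⟫ -
        μ / 2 * (2 * ⟪AffineMap.lineMap y x t, x - y⟫)) t := by
    have hl : HasDerivAt (AffineMap.lineMap y x : ℝ → E) (x - y) t :=
      AffineMap.hasDerivAt_lineMap
    have h1 := (hd (AffineMap.lineMap y x t)).hasFDerivAt.comp_hasDerivAt t hl
    rw [← inner_gradient_left] at h1
    exact h1.sub (hl.norm_sq.const_mul (μ / 2))
  have h0 := hφ.le_slope_of_hasDerivAt (Set.mem_univ 0) (Set.mem_univ 1) one_pos (hder 0)
  have h1 := hφ.slope_le_of_hasDerivAt (Set.mem_univ 0) (Set.mem_univ 1) one_pos (hder 1)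
  have h2 := h0.trans h1
  simp only [AffineMap.lineMap_apply_zero, AffineMap.lineMap_apply_one] at h2
  have h3 : ‖x - y‖ ^ 2 = ⟪x, x - y⟫ - ⟪y, x - y⟫ := by
    rw [← inner_sub_left, real_inner_self_eq_norm_sq]
  rw [h3, inner_sub_left]
  linarith

theorem gradient_eq_zero_of_isMinOn {f : E → ℝ} {x : E} (hx : IsMinOn f Set.univ x) :
    ∇ f x = 0 := by
  rw [gradient, (hx.isLocalMin univ_mem).fderiv_eq_zero, map_zero]

theorem hasFDerivAt_gradient {f : E → ℝ} (hf : ContDiff ℝ 2 f) (x : E) :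
    HasFDerivAt (∇ f) (fderiv ℝ (∇ f) x) x := by
  have h : Differentiable ℝ (fderiv ℝ f) :=
    (hf.fderiv_right (m := 1) (by norm_num)).differentiable (by norm_num)
  exact ((InnerProductSpace.toDual ℝ E).symm.toContinuousLinearEquiv.differentiable.comp
    h x).hasFDerivAt

theorem isSymmetric_fderiv_gradient {f : E → ℝ} (hf : ContDiff ℝ 2 f) (x : E) :
    (fderiv ℝ (∇ f) x).toLinearMap.IsSymmetric := by
  have h (v w : E) : fderiv ℝ (fderiv ℝ f) x v w = ⟪fderiv ℝ (∇ f) x v, w⟫ := by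
    have h1 := (InnerProductSpace.toDual ℝ E).toContinuousLinearEquiv.hasFDerivAt.comp x
      (hasFDerivAt_gradient hf x)
    have h2 : ((InnerProductSpace.toDual ℝ E).toContinuousLinearEquiv ∘ ∇ f) = fderiv ℝ f :=
      toDual_comp_gradient
    rw [h2] at h1
    rw [h1.fderiv]
    rfl
  intro v w
  change ⟪fderiv ℝ (∇ f) x v, w⟫ = ⟪v, fderiv ℝ (∇ f) x w⟫
  rw [real_inner_comm _ v, ← h, ← h]
  exact (hf.contDiffAt.isSymmSndFDerivAt (by simp)).eq v w

theorem le_inner_fderiv_gradient {f : E → ℝ} {μ : ℝ} (hf : StrongConvexOn Set.univ μ f)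
    (hf2 : ContDiff ℝ 2 f) (x z : E) : μ * ‖z‖ ^ 2 ≤ ⟪fderiv ℝ (∇ f) x z, z⟫ := by
  have hd : Differentiable ℝ f := hf2.differentiable (by norm_num)
  have hl : HasDerivAt (fun t : ℝ => x + t • z) z 0 := by
    simpa using ((hasDerivAt_id (0 : ℝ)).smul_const z).const_add x
  have h1 : HasDerivAt (fun t : ℝ => ∇ f (x + t • z)) (fderiv ℝ (∇ f) x z) 0 := by
    have := hasFDerivAt_gradient hf2 (x + (0 : ℝ) • z)
    have h2 := this.comp_hasDerivAt (0 : ℝ) hl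
    simpa [Function.comp_def] using h2
  have h2 := (hasDerivAt_iff_tendsto_slope_zero.1 h1).inner (𝕜 := ℝ)
    (tendsto_const_nhds (x := z))
  refine ge_of_tendsto h2 ?_
  filter_upwards [self_mem_nhdsWithin] with t ht
  have ht0 : t ≠ 0 := ht
  have h3 := strongly_monotone_gradient hf hd (x + t • z) x
  rw [add_sub_cancel_left, norm_smul, inner_smul_right, Real.norm_eq_abs, mul_pow, sq_abs] at h3
  simp only [zero_add, zero_smul, add_zero]
  rw [real_inner_smul_left]
  have h4 : t * ⟪∇ f (x + t • z) - ∇ f x, z⟫ =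
      t ^ 2 * (t⁻¹ * ⟪∇ f (x + t • z) - ∇ f x, z⟫) := by field_simp
  rw [h4] at h3
  have h5 : 0 < t ^ 2 := by positivity
  nlinarith

theorem norm_fderiv_gradient_le {f : E → ℝ} {L : ℝ} (hL : 0 ≤ L) (hf2 : ContDiff ℝ 2 f)
    (hlip : ∀ x y, ‖∇ f x - ∇ f y‖ ≤ L * ‖x - y‖) (x : E) : ‖fderiv ℝ (∇ f) x‖ ≤ L :=
  (hasFDerivAt_gradient hf2 x).le_of_lip' hL (Eventually.of_forall fun y => hlip y x)

/-- If the moduli of strong convexity and smoothness agree, the gradient is affine. -/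
theorem gradient_eq_smul_sub {f : E → ℝ} {μ : ℝ} (hf : StrongConvexOn Set.univ μ f)
    (hd : Differentiable ℝ f) (hμ : 0 < μ)
    (hlip : ∀ x y, ‖∇ f x - ∇ f y‖ ≤ μ * ‖x - y‖) {xs : E} (hxs : IsMinOn f Set.univ xs) (x : E) :
    ∇ f x = μ • (x - xs) := by
  have h1 := strongly_monotone_gradient hf hd x xs
  have h2 := hlip x xs
  rw [gradient_eq_zero_of_isMinOn hxs, sub_zero] at h1 h2
  have h3 : ‖∇ f x‖ ^ 2 ≤ (μ * ‖x - xs‖) ^ 2 := by gcongr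
  -- Expanding the square, the Lipschitz and monotonicity bounds give at most `(μ² - 2μ² + μ²) ‖x -
  -- xs‖² = 0`.
  have h4 : ‖∇ f x - μ • (x - xs)‖ ^ 2 ≤ 0 := by
    rw [norm_sub_sq_real, norm_smul, inner_smul_right, Real.norm_of_nonneg hμ.le]
    nlinarith
  have h5 : ‖∇ f x - μ • (x - xs)‖ = 0 := by
    nlinarith [norm_nonneg (∇ f x - μ • (x - xs)), sq_nonneg ‖∇ f x - μ • (x - xs)‖]
  exact sub_eq_zero.1 (norm_eq_zero.1 h5)

end Gradient

/-! ### From the matrix problem to norms of combinations -/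

section Matrix

variable {n k : ℕ}

theorem extrapolate_eq_combination (x : ℕ → EuclideanSpace ℝ (Fin n)) (c : Fin (k + 1) → ℝ) :
    extrapolate x c = combination x (WithLp.toLp 2 c) := rfl

theorem increments_mulVec (x : ℕ → EuclideanSpace ℝ (Fin n)) (c : Fin (k + 1) → ℝ) :
    (increments k x).mulVec c = (combination (diffs x) (WithLp.toLp 2 c)).ofLp := by
  ext j
  simp [increments, Matrix.mulVec, dotProduct, combination_apply, diffs, mul_comm]

theorem dotProduct_gram_mulVec (x : ℕ → EuclideanSpace ℝ (Fin n)) (b c : Fin (k + 1) → ℝ) :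
    b ⬝ᵥ ((increments k x).transpose * increments k x).mulVec c =
      ⟪combination (diffs x) (WithLp.toLp 2 b), combination (diffs x) (WithLp.toLp 2 c)⟫ := by
  rw [← Matrix.mulVec_mulVec, Matrix.dotProduct_mulVec, Matrix.vecMul_transpose,
    increments_mulVec, increments_mulVec, EuclideanSpace.inner_eq_star_dotProduct, dotProduct_comm]
  simp

theorem objective_eq (x : ℕ → EuclideanSpace ℝ (Fin n)) (lam : ℝ) (c : Fin (k + 1) → ℝ) :
    c ⬝ᵥ ((increments k x).transpose * increments k x + lam • (1 : Matrix _ _ ℝ)).mulVec c =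
      ‖combination (diffs x) (WithLp.toLp 2 c)‖ ^ 2 + lam * ‖WithLp.toLp 2 c‖ ^ 2 := by
  rw [Matrix.add_mulVec, dotProduct_add, dotProduct_gram_mulVec, real_inner_self_eq_norm_sq,
    Matrix.smul_mulVec, Matrix.one_mulVec, dotProduct_smul,
    EuclideanSpace.real_norm_sq_eq (WithLp.toLp 2 c)]
  simp [dotProduct, sq]

theorem isSolution_iff {x : ℕ → EuclideanSpace ℝ (Fin n)} {lam : ℝ} {c : Fin (k + 1) → ℝ} :
    IsSolution (increments k x) lam c ↔ ∑ i, c i = 1 ∧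
      ∀ d : EuclideanSpace ℝ (Fin (k + 1)), ∑ i, d i = 1 →
        ‖combination (diffs x) (WithLp.toLp 2 c)‖ ^ 2 + lam * ‖WithLp.toLp 2 c‖ ^ 2 ≤
          ‖combination (diffs x) d‖ ^ 2 + lam * ‖d‖ ^ 2 := by
  simp only [IsSolution, isMinOn_iff, Set.mem_ofPred_eq, objective_eq]
  exact and_congr_right fun _ => ⟨fun h d hd => h d hd, fun h d hd => h (WithLp.toLp 2 d) hd⟩

/-- A linear image attains its minimal norm on every nonempty affine hyperplane. -/
theorem exists_forall_norm_map_le {V F : Type*} [AddCommGroup V] [Module ℝ V]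
    [FiniteDimensional ℝ V] [NormedAddCommGroup F] [InnerProductSpace ℝ F] (T : V →ₗ[ℝ] F)
    (S : V →ₗ[ℝ] ℝ) {e : V} (he : S e = 1) :
    ∃ c, S c = 1 ∧ ∀ d, S d = 1 → ‖T c‖ ≤ ‖T d‖ := by
  -- Project `T e` onto the image of `ker S`. Working in the image requires no injectivity of `T`.
  obtain ⟨_, ⟨a, ha, rfl⟩, hmin⟩ :=
    ((LinearMap.ker S).map T).exists_norm_eq_iInf_of_complete_subspace
      (Submodule.complete_of_finiteDimensional _) (T e)
  refine ⟨e - a, by rw [map_sub, he, LinearMap.mem_ker.1 ha, sub_zero], fun d hd => ?_⟩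
  have hmem : T (e - d) ∈ (LinearMap.ker S).map T :=
    Submodule.mem_map_of_mem (by rw [LinearMap.mem_ker, map_sub, he, hd, sub_self])
  rw [map_sub, hmin]
  refine (ciInf_le ⟨0, ?_⟩ (⟨T (e - d), hmem⟩ : (LinearMap.ker S).map T)).trans_eq ?_
  · rintro _ ⟨w, rfl⟩
    exact norm_nonneg _
  · rw [← map_sub, sub_sub_cancel]

/-- The objective is the squared norm of the linear map `c ↦ (Ũ c, √λ c)`, so a minimizer exists
even when `λ = 0`. -/
theorem exists_isSolution (x : ℕ → EuclideanSpace ℝ (Fin n)) {lam : ℝ} (hlam : 0 ≤ lam) :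
    ∃ c : Fin (k + 1) → ℝ, IsSolution (increments k x) lam c := by
  set T : EuclideanSpace ℝ (Fin (k + 1)) →ₗ[ℝ]
      WithLp 2 (EuclideanSpace ℝ (Fin n) × EuclideanSpace ℝ (Fin (k + 1))) :=
    (WithLp.linearEquiv 2 ℝ _).symm.toLinearMap ∘ₗ
      (combination (diffs x)).prod (√lam • LinearMap.id)
  have hT (c) : ‖T c‖ ^ 2 = ‖combination (diffs x) c‖ ^ 2 + lam * ‖c‖ ^ 2 := by
    rw [WithLp.prod_norm_sq_eq_of_L2]
    change ‖combination (diffs x) c‖ ^ 2 + ‖√lam • c‖ ^ 2 = _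
    rw [norm_smul, mul_pow, Real.norm_eq_abs, sq_abs, Real.sq_sqrt hlam]
  clear_value T
  obtain ⟨S, hS⟩ : ∃ S : EuclideanSpace ℝ (Fin (k + 1)) →ₗ[ℝ] ℝ, ∀ c, S c = ∑ i, c i :=
    ⟨{ toFun := fun c => ∑ i, c i
       map_add' := fun c d => by simp [Finset.sum_add_distrib]
       map_smul' := fun r c => by simp [Finset.mul_sum] }, fun _ => rfl⟩
  have hSe : S (EuclideanSpace.single 0 1) = 1 := by simp [hS]
  obtain ⟨c, hc, hmin⟩ := exists_forall_norm_map_le T S hSe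
  refine ⟨c.ofLp, isSolution_iff.2 ⟨hS c ▸ hc, fun d hd => ?_⟩⟩
  rw [WithLp.toLp_ofLp, ← hT, ← hT]
  exact pow_le_pow_left₀ (norm_nonneg _) (hmin d ((hS d).trans hd)) 2

theorem specNorm_nonneg {m : ℕ} (P : Matrix (Fin m) (Fin m) ℝ) : 0 ≤ specNorm P :=
  norm_nonneg _

theorem specNorm_smul {m : ℕ} (r : ℝ) (P : Matrix (Fin m) (Fin m) ℝ) :
    specNorm (r • P) = |r| * specNorm P := by
  rw [specNorm, map_smul, norm_smul, Real.norm_eq_abs, specNorm]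

theorem specNorm_zero {m : ℕ} : specNorm (0 : Matrix (Fin m) (Fin m) ℝ) = 0 := by
  simp [specNorm]

theorem continuous_specNorm {m : ℕ} :
    Continuous (specNorm : Matrix (Fin m) (Fin m) ℝ → ℝ) :=
  (LinearMap.continuous_of_finiteDimensional
    (Matrix.toEuclideanCLM (n := Fin m) (𝕜 := ℝ)).toAlgEquiv.toLinearMap).norm

theorem abs_dotProduct_mulVec_le {m : ℕ} (P : Matrix (Fin m) (Fin m) ℝ) (b c : Fin m → ℝ) :
    |b ⬝ᵥ P.mulVec c| ≤ specNorm P * ‖WithLp.toLp 2 b‖ * ‖WithLp.toLp 2 c‖ := by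
  have h : b ⬝ᵥ P.mulVec c =
      ⟪WithLp.toLp 2 b, Matrix.toEuclideanCLM (𝕜 := ℝ) P (WithLp.toLp 2 c)⟫ := by
    rw [EuclideanSpace.inner_eq_star_dotProduct, dotProduct_comm]
    simp
  rw [h, mul_right_comm, mul_comm]
  exact (abs_real_inner_le_norm _ _).trans
    (mul_le_mul_of_nonneg_left (ContinuousLinearMap.le_opNorm _ _) (norm_nonneg _))

end Matrix

/-! ### Blow-up at the minimizer -/

variable {n k : ℕ}

theorem hasFDerivAt_gradStep {f : EuclideanSpace ℝ (Fin n) → ℝ} (hf : ContDiff ℝ 2 f) (h : ℝ)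
    (x : EuclideanSpace ℝ (Fin n)) :
    HasFDerivAt (gradStep f h)
      ((1 : EuclideanSpace ℝ (Fin n) →L[ℝ] EuclideanSpace ℝ (Fin n)) - h • hessian f x) x :=
  (hasFDerivAt_id x).sub ((hasFDerivAt_gradient hf x).const_smul h)

theorem iter_linModel_sub (g : EuclideanSpace ℝ (Fin n) → EuclideanSpace ℝ (Fin n))
    (xs x : EuclideanSpace ℝ (Fin n)) (i : ℕ) :
    iter (linModel g xs) x i - xs = (fderiv ℝ g xs ^ i) (x - xs) := by
  induction i with
  | zero => simp [iter]
  | succ i ih =>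
    rw [iter, Function.iterate_succ_apply', ← iter, linModel, ih, add_sub_cancel_left, pow_succ']
    rfl

theorem diffs_sub_const {E : Type*} [NormedAddCommGroup E] (y : ℕ → E) (a : E) :
    diffs (fun i => y i - a) = diffs y := by
  funext i
  simp [diffs]

theorem diffs_iter_linModel (g : EuclideanSpace ℝ (Fin n) → EuclideanSpace ℝ (Fin n))
    (xs x : EuclideanSpace ℝ (Fin n)) :
    diffs (iter (linModel g xs) x) = diffs fun i => (fderiv ℝ g xs ^ i) (x - xs) := by
  rw [← diffs_sub_const _ xs]
  simp only [iter_linModel_sub]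

theorem combination_sub_const {E : Type*} [NormedAddCommGroup E] [InnerProductSpace ℝ E]
    (y : ℕ → E) (a : E) {c : EuclideanSpace ℝ (Fin (k + 1))} (hc : ∑ i, c i = 1) :
    combination (fun i => y i - a) c = combination y c - a := by
  simp [combination_apply, smul_sub, ← Finset.sum_smul, hc]

theorem diffs_smul {E : Type*} [NormedAddCommGroup E] [InnerProductSpace ℝ E] (r : ℝ) (y : ℕ → E) :
    diffs (fun i => r • y i) = fun i => r • diffs y i := by
  funext i
  simp [diffs, smul_sub]

theorem dotProduct_perturbation_mulVec
    (g : EuclideanSpace ℝ (Fin n) → EuclideanSpace ℝ (Fin n))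
    (xs x : EuclideanSpace ℝ (Fin n)) (b c : Fin (k + 1) → ℝ) :
    b ⬝ᵥ (perturbation g xs k x).mulVec c =
      ⟪combination (diffs (iter g x)) (WithLp.toLp 2 b),
        combination (diffs (iter g x)) (WithLp.toLp 2 c)⟫ -
      ⟪combination (diffs fun i => (fderiv ℝ g xs ^ i) (x - xs)) (WithLp.toLp 2 b),
        combination (diffs fun i => (fderiv ℝ g xs ^ i) (x - xs)) (WithLp.toLp 2 c)⟫ := by
  rw [perturbation, Matrix.sub_mulVec, dotProduct_sub, dotProduct_gram_mulVec,
    dotProduct_gram_mulVec, diffs_iter_linModel]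

theorem perturbation_apply
    (g : EuclideanSpace ℝ (Fin n) → EuclideanSpace ℝ (Fin n))
    (xs x : EuclideanSpace ℝ (Fin n)) (i j : Fin (k + 1)) :
    perturbation g xs k x i j = ⟪diffs (iter g x) i, diffs (iter g x) j⟫ -
      ⟪diffs (fun i => (fderiv ℝ g xs ^ i) (x - xs)) i,
        diffs (fun i => (fderiv ℝ g xs ^ i) (x - xs)) j⟫ := by
  have h := dotProduct_perturbation_mulVec g xs x (Pi.single i 1) (Pi.single j 1)
  simpa [combination_apply, Pi.single_apply, ite_smul] using h

/-- Along an ultrafilter at a fixed point `xs`, the limit of regularized extrapolation errors,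
normalized by the distance to `xs`, is controlled by every fixed extrapolation of the
linearized iteration. -/
theorem exists_tendsto_normalized_error {g : EuclideanSpace ℝ (Fin n) → EuclideanSpace ℝ (Fin n)}
    {A : EuclideanSpace ℝ (Fin n) →L[ℝ] EuclideanSpace ℝ (Fin n)}
    {xs : EuclideanSpace ℝ (Fin n)} (hg : HasFDerivAt g A xs) (hxs : g xs = xs)
    {m β : ℝ} (hm : 0 < m)
    (hA : ∀ z, m * ‖z‖ ≤ ‖(A - 1 : EuclideanSpace ℝ (Fin n) →L[ℝ] _) z‖) (hβ : 0 < β)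
    (l : Ultrafilter (EuclideanSpace ℝ (Fin n))) (hl : ↑l ≤ 𝓝 xs) (hne : ∀ᶠ x in l, x ≠ xs)
    {c : EuclideanSpace ℝ (Fin n) → Fin (k + 1) → ℝ}
    (hc : ∀ᶠ x in l, IsSolution (increments k (iter g x))
      (β * specNorm (perturbation g xs k x)) (c x)) :
    ∃ v z : EuclideanSpace ℝ (Fin n), ‖v‖ = 1 ∧
      Tendsto (fun x => ‖x - xs‖⁻¹ • (extrapolate (iter g x) (c x) - xs)) l (𝓝 z) ∧
      ∀ d : EuclideanSpace ℝ (Fin (k + 1)), ∑ i, d i = 1 →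
        ‖(A - 1 : EuclideanSpace ℝ (Fin n) →L[ℝ] _) z‖ ≤
          ‖(A - 1 : EuclideanSpace ℝ (Fin n) →L[ℝ] _) (combination (fun i => (A ^ i) v) d)‖ := by
  set y : EuclideanSpace ℝ (Fin n) → ℕ → EuclideanSpace ℝ (Fin n) :=
    fun x i => ‖x - xs‖⁻¹ • (iter g x i - xs) with hydef
  have hy0 (x) : y x 0 = ‖x - xs‖⁻¹ • (x - xs) := rfl
  have hnorm : ∀ᶠ x in l, ‖y x 0‖ = 1 := by
    filter_upwards [hne] with x hx
    rw [hy0, norm_smul, norm_inv, norm_norm, inv_mul_cancel₀]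
    exact norm_ne_zero_iff.2 (sub_ne_zero.2 hx)
  obtain ⟨v, hv, hvl⟩ := (isCompact_sphere (0 : EuclideanSpace ℝ (Fin n)) 1).ultrafilter_le_nhds
    (l.map fun x => y x 0) (by
      rw [Ultrafilter.coe_map, le_principal_iff, mem_map]
      filter_upwards [hnorm] with x hx
      simpa using hx)
  replace hvl : Tendsto (fun x => y x 0) l (𝓝 v) := hvl
  have hyA (i : ℕ) : Tendsto (fun x => (A ^ i) (y x 0)) l (𝓝 ((A ^ i) v)) :=
    ((A ^ i).continuous.tendsto v).comp hvl
  -- The `i`-th iterate of `g` has derivative `A ^ i` at the fixed point, so its normalized error is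
  -- `(A ^ i) (y x 0) + o(1)`.
  have hy (i : ℕ) : Tendsto (fun x => y x i) l (𝓝 ((A ^ i) v)) := by
    have h1 := ((hg.iterate hxs i).isLittleO.norm_right.tendsto_inv_smul_nhds_zero).mono_left hl
    have h2 := h1.add (hyA i)
    rw [zero_add] at h2
    refine h2.congr fun x => ?_
    rw [hy0, map_smul, ← smul_add, sub_add_cancel, Function.iterate_fixed hxs]
    rfl
  have hdy (x) : diffs (y x) = fun i => ‖x - xs‖⁻¹ • diffs (iter g x) i := by
    rw [hydef, diffs_smul, diffs_sub_const]
  have hdA (x) : (diffs fun i => (A ^ i) (y x 0)) =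
      fun i => ‖x - xs‖⁻¹ • diffs (fun i => (A ^ i) (x - xs)) i := by
    simp only [hy0, map_smul, diffs_smul]
  have hfd : fderiv ℝ g xs = A := hg.fderiv
  set ρ : EuclideanSpace ℝ (Fin n) → ℝ :=
    fun x => specNorm (‖x - xs‖⁻¹ ^ 2 • perturbation g xs k x) with hρdef
  have hρx (x) : ρ x = ‖x - xs‖⁻¹ ^ 2 * specNorm (perturbation g xs k x) := by
    rw [hρdef]
    simp only
    rw [specNorm_smul, abs_of_nonneg (sq_nonneg _)]
  -- Each entry of the rescaled `P` is a difference of inner products with a common limit.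
  have hρ : Tendsto ρ l (𝓝 0) := by
    rw [← specNorm_zero (m := k + 1)]
    refine (continuous_specNorm.tendsto _).comp ?_
    refine tendsto_pi_nhds.2 fun i => tendsto_pi_nhds.2 fun j => ?_
    have h1 := ((tendsto_diffs hy i).inner (𝕜 := ℝ) (tendsto_diffs hy j)).sub
      ((tendsto_diffs hyA i).inner (𝕜 := ℝ) (tendsto_diffs hyA j))
    rw [sub_self] at h1
    refine h1.congr fun x => ?_
    rw [hdy, hdA, Matrix.smul_apply, perturbation_apply, hfd]
    simp only [real_inner_smul_left, real_inner_smul_right, smul_eq_mul]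
    ring
  have hP (x) (b d : EuclideanSpace ℝ (Fin (k + 1))) :
      |⟪combination (diffs (y x)) b, combination (diffs (y x)) d⟫ -
        ⟪combination (diffs fun i => (A ^ i) (y x 0)) b,
          combination (diffs fun i => (A ^ i) (y x 0)) d⟫| ≤ ρ x * ‖b‖ * ‖d‖ := by
    have h := abs_dotProduct_mulVec_le (‖x - xs‖⁻¹ ^ 2 • perturbation g xs k x) b.ofLp d.ofLp
    rw [Matrix.smul_mulVec, dotProduct_smul, dotProduct_perturbation_mulVec, hfd] at h
    rw [hdy, hdA]
    simp only [combination_smul, real_inner_smul_left, real_inner_smul_right]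
    refine le_trans (le_of_eq ?_) h
    rw [smul_eq_mul]
    congr 1
    ring
  obtain ⟨z, hz, hle⟩ := exists_tendsto_minimizers l hm hA hβ hy
    (ρ := ρ) (fun x => specNorm_nonneg _) hρ hP (c := fun x => WithLp.toLp 2 (c x))
    (hc.mono fun x hx => hx.1) (fun d hd => hc.mono fun x hx => by
      have h := mul_le_mul_of_nonneg_left ((isSolution_iff.1 hx).2 d hd)
        (sq_nonneg ‖x - xs‖⁻¹)
      have hn (b : EuclideanSpace ℝ (Fin (k + 1))) : ‖combination (diffs (y x)) b‖ ^ 2 =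
          ‖x - xs‖⁻¹ ^ 2 * ‖combination (diffs (iter g x)) b‖ ^ 2 := by
        rw [hdy, combination_smul, norm_smul, mul_pow, norm_inv, norm_norm]
      rw [hn, hn, hρx]
      linarith)
  refine ⟨v, z, by simpa using hv, hz.congr' ?_, hle⟩
  filter_upwards [hc] with x hx
  rw [hydef]
  simp only
  rw [combination_smul, combination_sub_const _ _ (by exact hx.1), extrapolate_eq_combination]

theorem mul_norm_le_norm_of_le_inner {E : Type*} [NormedAddCommGroup E] [InnerProductSpace ℝ E]
    {H : E →L[ℝ] E} {μ : ℝ} (hlow : ∀ z, μ * ‖z‖ ^ 2 ≤ ⟪H z, z⟫) (z : E) :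
    μ * ‖z‖ ≤ ‖H z‖ := by
  rcases eq_or_ne z 0 with rfl | hz
  · simp
  · refine le_of_mul_le_mul_right ?_ (norm_pos_iff.2 hz)
    have h := (hlow z).trans (real_inner_le_norm _ _)
    rwa [sq, ← mul_assoc] at h

/-- An extrapolation of a gradient step's linearization whose residual is at most that of every
fixed extrapolation satisfies the Chebyshev bound. -/
theorem norm_le_of_residual_le {E : Type*} [NormedAddCommGroup E] [InnerProductSpace ℝ E]
    [FiniteDimensional ℝ E] {H : E →L[ℝ] E} (hH : H.toLinearMap.IsSymmetric) {μ L h : ℝ}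
    (hμ : 0 < μ) (hμL : μ ≤ L) (hh : 0 < h) (hlow : ∀ z, μ * ‖z‖ ^ 2 ≤ ⟪H z, z⟫) (hup : ‖H‖ ≤ L)
    {v z : E} (hz : ∀ d : EuclideanSpace ℝ (Fin (k + 1)), ∑ i, d i = 1 →
      ‖H z‖ ≤ ‖H (combination (fun i => ((1 - h • H : E →L[ℝ] E) ^ i) v) d)‖) :
    ‖z‖ ≤ L / μ * chebyshevRate k (1 - μ / L) * ‖v‖ := by
  have hL : 0 < L := hμ.trans_le hμL
  obtain ⟨p, hpk, hp1, hp⟩ := exists_polynomial_abs_eval_le hμ hμL hh.ne' k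
  have hup' (z : E) : ⟪H z, z⟫ ≤ L * ‖z‖ ^ 2 := by
    refine (real_inner_le_norm _ _).trans ?_
    rw [sq, ← mul_assoc]
    gcongr
    exact H.le_of_opNorm_le hup z
  have hrate : 0 ≤ chebyshevRate k (1 - μ / L) :=
    (abs_nonneg _).trans (hp μ ⟨le_rfl, hμL⟩)
  have h1 := hz (coeffs k p) (by rw [sum_coeffs hpk, hp1])
  rw [combination_coeffs hpk] at h1
  have h2 : Polynomial.aeval (1 - h • H : E →L[ℝ] E) p =
      Polynomial.aeval H (p.comp (1 - Polynomial.C h * Polynomial.X)) := by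
    rw [Polynomial.aeval_comp]
    simp [Algebra.algebraMap_eq_smul_one]
  have h3 := norm_aeval_le_of_isSymmetric hH hlow hup' hrate
    (q := p.comp (1 - Polynomial.C h * Polynomial.X))
    (fun t ht => by simpa using hp t ht) v
  rw [h2] at h1
  -- The factor `κ` arises in passing between residual and error: `L` from applying `H`, `1 / μ`
  -- from inverting it.
  have h4 : ‖H z‖ ≤ L * (chebyshevRate k (1 - μ / L) * ‖v‖) :=
    h1.trans ((H.le_of_opNorm_le hup _).trans (mul_le_mul_of_nonneg_left h3 hL.le))
  have h5 := mul_norm_le_norm_of_le_inner hlow z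
  rw [div_mul_eq_mul_div, div_mul_eq_mul_div, le_div_iff₀ hμ]
  linarith

theorem norm_sub_smul_sub_one {E : Type*} [NormedAddCommGroup E] [InnerProductSpace ℝ E]
    (H : E →L[ℝ] E) {h : ℝ} (hh : 0 < h) (z : E) :
    ‖((1 - h • H : E →L[ℝ] E) - 1 : E →L[ℝ] E) z‖ = h * ‖H z‖ := by
  rw [sub_sub_cancel_left]
  simp [norm_smul, abs_of_pos hh]

/-- If the two moduli agree, the gradient step coincides with its linear model, the
regularization vanishes, and the extrapolation bound holds at every starting point. -/
theorem norm_extrapolate_sub_le_of_eq {μ h β : ℝ}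
    (hμ : 0 < μ) (hh : 0 < h) {f : EuclideanSpace ℝ (Fin n) → ℝ} (hsmooth : LSmooth μ f)
    (hconv : StrongConvexOn Set.univ μ f) (hf : ContDiff ℝ 2 f)
    {xs : EuclideanSpace ℝ (Fin n)} (hxs : IsMinOn f Set.univ xs) (x : EuclideanSpace ℝ (Fin n))
    {c : Fin (k + 1) → ℝ} (hc : IsSolution (increments k (iter (gradStep f h) x))
      (β * specNorm (perturbation (gradStep f h) xs k x)) c) :
    ‖extrapolate (iter (gradStep f h) x) c - xs‖ ≤
      μ / μ * chebyshevRate k (1 - μ / μ) * ‖x - xs‖ := by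
  have hgrad := gradient_eq_smul_sub hconv hsmooth.1 hμ hsmooth.2 hxs
  have hA := hasFDerivAt_gradStep hf h xs
  have hH : hessian f xs = μ • (1 : EuclideanSpace ℝ (Fin n) →L[ℝ] _) := by
    rw [hessian, funext hgrad]
    exact (((hasFDerivAt_id xs).sub_const xs).const_smul μ).fderiv
  have hmodel : linModel (gradStep f h) xs = gradStep f h := by
    funext x
    rw [linModel, hA.fderiv, hH, gradStep, hgrad]
    simp only [sub_apply, smul_apply, one_apply_eq_self]
    abel
  have hiter (i : ℕ) : iter (gradStep f h) x i - xs =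
      ((1 - h • hessian f xs : EuclideanSpace ℝ (Fin n) →L[ℝ] _) ^ i) (x - xs) := by
    rw [← hA.fderiv, ← iter_linModel_sub, hmodel]
  have hP : perturbation (gradStep f h) xs k x = 0 := by
    rw [perturbation, hmodel, sub_self]
  rw [hP, specNorm_zero, mul_zero] at hc
  obtain ⟨hc1, hmin⟩ := isSolution_iff.1 hc
  rw [← diffs_sub_const _ xs] at hmin
  simp only [hiter, zero_mul, add_zero] at hmin
  rw [extrapolate_eq_combination, ← combination_sub_const _ _ (by exact hc1)]
  simp only [hiter]
  refine norm_le_of_residual_le (isSymmetric_fderiv_gradient hf xs) hμ le_rfl hh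
    (le_inner_fderiv_gradient hconv hf xs)
    (norm_fderiv_gradient_le hμ.le hf hsmooth.2 xs) (k := k) fun d hd => ?_
  have h1 := (pow_le_pow_iff_left₀ (norm_nonneg _) (norm_nonneg _) two_ne_zero).1 (hmin d hd)
  rw [combination_diffs_pow, combination_diffs_pow, norm_sub_smul_sub_one _ hh,
    norm_sub_smul_sub_one _ hh] at h1
  exact le_of_mul_le_mul_left h1 hh

/-- Any factor above the Chebyshev bound holds for regularized extrapolation near the minimizer. -/
theorem eventually_norm_extrapolate_sub_le {μ L h β C : ℝ}
    (hμ : 0 < μ) (hμL : μ ≤ L) (hh : 0 < h) (hβ : 0 < β)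
    {f : EuclideanSpace ℝ (Fin n) → ℝ} (hsmooth : LSmooth L f)
    (hconv : StrongConvexOn Set.univ μ f) (hf : ContDiff ℝ 2 f)
    {xs : EuclideanSpace ℝ (Fin n)} (hxs : IsMinOn f Set.univ xs)
    (hC : L / μ * chebyshevRate k (1 - μ / L) < C) :
    ∀ᶠ x in 𝓝 xs, ∀ c : Fin (k + 1) → ℝ, IsSolution (increments k (iter (gradStep f h) x))
      (β * specNorm (perturbation (gradStep f h) xs k x)) c →
      ‖extrapolate (iter (gradStep f h) x) c - xs‖ ≤ C * ‖x - xs‖ := by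
  have hA := hasFDerivAt_gradStep hf h xs
  have hfix : gradStep f h xs = xs := by
    rw [gradStep, gradient_eq_zero_of_isMinOn hxs, smul_zero, sub_zero]
  have hlow := le_inner_fderiv_gradient hconv hf xs
  by_contra hcon
  set B : Set (EuclideanSpace ℝ (Fin n)) := {x | ∃ c : Fin (k + 1) → ℝ,
    IsSolution (increments k (iter (gradStep f h) x))
      (β * specNorm (perturbation (gradStep f h) xs k x)) c ∧
      C * ‖x - xs‖ < ‖extrapolate (iter (gradStep f h) x) c - xs‖} with hB
  have hfreq : ∃ᶠ x in 𝓝 xs, x ∈ B := by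
    rw [not_eventually] at hcon
    refine hcon.mono fun x hx => ?_
    push Not at hx
    exact hx
  have : (𝓝 xs ⊓ 𝓟 B).NeBot := frequently_mem_iff_neBot.1 hfreq
  set l := Ultrafilter.of (𝓝 xs ⊓ 𝓟 B)
  have hl : ↑l ≤ 𝓝 xs ⊓ 𝓟 B := Ultrafilter.of_le _
  have hlB : ∀ᶠ x in l, x ∈ B := hl.trans inf_le_right (mem_principal_self B)
  choose! c hcsol hclt using fun x (hx : x ∈ B) => hx
  -- Started at `xs`, the iteration is constant and extrapolation is exact, so `xs` is not a bad
  -- point and normalization is legitimate.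
  have hne : ∀ᶠ x in l, x ≠ xs := by
    filter_upwards [hlB] with x hx
    rintro rfl
    refine absurd (hclt x hx) ?_
    have hconst (i : ℕ) : iter (gradStep f h) x i = x := Function.iterate_fixed hfix i
    simp [extrapolate, hconst, ← Finset.sum_smul, (hcsol x hx).1]
  obtain ⟨v, z, hv, hz, hle⟩ := exists_tendsto_normalized_error hA hfix (mul_pos hh hμ)
    (fun z => by
      rw [norm_sub_smul_sub_one _ hh, mul_assoc]
      exact mul_le_mul_of_nonneg_left (mul_norm_le_norm_of_le_inner hlow z) hh.le)
    hβ l (hl.trans inf_le_left) hne (hlB.mono hcsol)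
  have h1 : ‖z‖ ≤ L / μ * chebyshevRate k (1 - μ / L) * ‖v‖ := by
    refine norm_le_of_residual_le (isSymmetric_fderiv_gradient hf xs) hμ hμL hh hlow
      (norm_fderiv_gradient_le (hμ.le.trans hμL) hf hsmooth.2 xs) fun d hd => ?_
    have h2 := hle d hd
    rw [norm_sub_smul_sub_one _ hh, norm_sub_smul_sub_one _ hh] at h2
    exact le_of_mul_le_mul_left h2 hh
  have h2 : C ≤ ‖z‖ := by
    refine ge_of_tendsto hz.norm ?_
    filter_upwards [hlB, hne] with x hx hxne
    rw [norm_smul, norm_inv, norm_norm, ← div_eq_inv_mul,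
      le_div_iff₀ (norm_pos_iff.2 (sub_ne_zero.2 hxne))]
    exact (hclt x hx).le
  rw [hv, mul_one] at h1
  linarith

theorem le_of_strongConvexOn_of_lSmooth [Nontrivial (EuclideanSpace ℝ (Fin n))] {μ L : ℝ}
    {f : EuclideanSpace ℝ (Fin n) → ℝ} (hsmooth : LSmooth L f)
    (hconv : StrongConvexOn Set.univ μ f) : μ ≤ L := by
  obtain ⟨z, hz⟩ := exists_ne (0 : EuclideanSpace ℝ (Fin n))
  have h1 := strongly_monotone_gradient hconv hsmooth.1 z 0
  have h2 := (h1.trans (real_inner_le_norm _ _)).trans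
    (mul_le_mul_of_nonneg_right (hsmooth.2 z 0) (norm_nonneg _))
  rw [sub_zero, sq, ← mul_assoc] at h2
  have hz' := norm_pos_iff.2 hz
  exact le_of_mul_le_mul_right (le_of_mul_le_mul_right h2 hz') hz'

end RMPE


theorem mainTheorem2 (n k : ℕ) (μ L M h β : ℝ) (hμ : 0 < μ)
    (hh : h ∈ Set.Ioo 0 (2 / L)) (hβ : 0 < β)
    (f : EuclideanSpace ℝ (Fin n) → ℝ)
    (hsmooth : RMPE.LSmooth L f)
    (hconv : StrongConvexOn Set.univ μ f)
    (hhess : RMPE.LipschitzHessian M f)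
    (xs : EuclideanSpace ℝ (Fin n)) (hxs : IsMinOn f Set.univ xs) :
    (μ < L →
      |RMPE.rescaledChebyshev k (1 - μ / L) (1 - μ / L)| = RMPE.chebyshevRate k (1 - μ / L)) ∧
    ∀ᶠ x₀ in 𝓝 xs,
      (∃ c : Fin (k + 1) → ℝ,
        RMPE.IsSolution (RMPE.increments k (RMPE.iter (RMPE.gradStep f h) x₀))
          (β * RMPE.specNorm (RMPE.perturbation (RMPE.gradStep f h) xs k x₀)) c) ∧
      ∀ c : Fin (k + 1) → ℝ,
        RMPE.IsSolution (RMPE.increments k (RMPE.iter (RMPE.gradStep f h) x₀))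
          (β * RMPE.specNorm (RMPE.perturbation (RMPE.gradStep f h) xs k x₀)) c →
        ‖RMPE.extrapolate (RMPE.iter (RMPE.gradStep f h) x₀) c - xs‖ ≤
          √(1 + (1 + 1 / β) ^ 2 / (4 * β ^ 2)) * (L / μ) * RMPE.chebyshevRate k (1 - μ / L) *
            ‖x₀ - xs‖ := by
  -- For `L ≤ 0` the step-size interval is empty; this includes `L = 0`, where `2 / 0 = 0`.
  have hL : 0 < L := by
    by_contra hL
    exact absurd (hh.1.trans hh.2) (div_nonpos_of_nonneg_of_nonpos two_pos.le (not_lt.1 hL)).not_gt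
  have hσ (hlt : μ < L) : 0 < 1 - μ / L := by
    rw [sub_pos, div_lt_one hL]
    exact hlt
  refine ⟨fun hlt => RMPE.abs_rescaledChebyshev_self (hσ hlt)
    (sub_lt_self 1 (div_pos hμ hL)) k, ?_⟩
  refine Filter.Eventually.and (Filter.Eventually.of_forall fun x₀ => RMPE.exists_isSolution _
    (mul_nonneg hβ.le (RMPE.specNorm_nonneg _))) ?_
  -- Dimension zero is separate because `μ ≤ L` needs a nonzero vector.
  rcases subsingleton_or_nontrivial (EuclideanSpace ℝ (Fin n)) with hn | hn
  · refine Filter.Eventually.of_forall fun x₀ c _ => ?_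
    rw [Subsingleton.elim (RMPE.extrapolate _ c) xs, Subsingleton.elim x₀ xs]
    simp
  have hμL := RMPE.le_of_strongConvexOn_of_lSmooth hsmooth hconv
  have hconst : 1 < √(1 + (1 + 1 / β) ^ 2 / (4 * β ^ 2)) := by
    rw [Real.lt_sqrt one_pos.le, one_pow]
    exact lt_add_of_pos_right 1 (by positivity)
  rcases hμL.eq_or_lt with rfl | hlt
  · refine Filter.Eventually.of_forall fun x₀ c hc => ?_
    have hle := RMPE.norm_extrapolate_sub_le_of_eq hμ hh.1 hsmooth hconv hhess.1 hxs x₀ hc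
    rw [mul_assoc, mul_assoc, ← mul_assoc (μ / μ)]
    exact hle.trans (le_mul_of_one_le_left ((norm_nonneg _).trans hle) hconst.le)
  · refine RMPE.eventually_norm_extrapolate_sub_le hμ hμL hh.1 hβ hsmooth hconv hhess.1 hxs ?_
    rw [mul_assoc]
    exact lt_mul_of_one_lt_left
      (mul_pos (div_pos hL hμ) (RMPE.chebyshevRate_pos (hσ hlt) k)) hconst
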